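/- **Setting.** Let $\Lambda$ be a finite metric space of sites, with a Hilbert space $\mathbb C^D$ at each site and total Hilbert space $\bigotimes_{i\in\Lambda}\mathbb C^D$. An operator is supported on $X\subseteq\Lambda$ if it has the form $I_{\Lambda\setminus X}\otimes P$. Let $H=\sum_{Z\subseteq\Lambda} H_Z$ with $H_Z$ Hermitian and supported on $Z$, and write $O(t)=e^{iHt}Oe^{-iHt}$. For $\mu,s>0$ call $H$ $(\mu,s)$-local if $\sum_{Z\ni i}\Vert H_Z\Vert\,|Z|\,e^{\mu\,\mathrm{diam}(Z)}\le s$ for every site $i$. Say that $\Lambda$ is $d$-dimensional with volume constant $C$ if every $X\subseteq\Lambda$ with $\mathrm{diam}(X)\le l$, where $l\ge 1$, has $|X|\le C\,l^d$. Orthonormal states $\psi_1,\dots,\psi_k$ have *$(l,\epsilon)$ topological order* if for every operator $O$ supported on a set of diameter at most $l$ the matrix $M_{ab}=\langle\psi_a,O\psi_b\rangle$ satisfies $\Vert M-zI\Vert\le\epsilon\Vert O\Vert$ for some $z\in\mathbb C$ (operator norms). A state $\phi$ and a partner $\phi'$ are the case $k=2$. **Theorem.** For all $\mu,s>0$ there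 are a velocity $v_{LR}>0$ and an exponentially decaying function $g\ge 0$ on $[0,\infty)$, both depending only on $\mu$ and $s$, with the following properties. For every $\Lambda$, every $D$ and every $(\mu,s)$-local $H$, the Lieb–Robinson bound holds with $v_{LR}$ and $g$: if $A$ is supported on $X$, $B$ on $Y$, $r=\mathrm{dist}(X,Y)>0$ and $|t|\le r/v_{LR}$, then $\Vert[A(t),B]\Vert\le \frac{v_{LR}|t|}{r}\,g(r)\,|X|\,\Vert A\Vert\,\Vert B\Vert$. If moreover $\Lambda$ is $d$-dimensional with volume constant $C$, then for all real $\epsilon$, $l\ge1$, $t$ and $m\ge v_{LR}|t|$: 1. If $\phi_1,\dots,\phi_k$ have $(l,\epsilon)$ topological order, then $e^{-iHt}\phi_1,\dots,e^{-iHt}\phi_k$ have $(l-m,\ \epsilon+g(m)\,C\,l^d)$ topological order. 2. Conversely, if $e^{-iHt}\phi_1,\dots,e^{-iHt}\phi_k$ have $(l,\epsilon)$ topological order, then $\phi_1,\dots,\phi_k$ have $(l-m,\ \epsilon+g(m)\,C\,l^d)$ topological order. 3. If $\phi=\bigotimes_i u_i$ is a product of unit vectors (for example $|{\uparrow\uparrow\uparrow\dots}\rangle$),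 $m\le l$, and for some state $\psi'$ the pair $e^{-iHt}\phi,\psi'$ has $(l,\epsilon)$ topological order, then $\epsilon+g(m)\,C\,l^d\ge \frac{1}{2|\Lambda|}$. Finally, for all $d$, $C$ and $c_0,\kappa_0>0$ there are $c_1,\kappa_1>0$, depending only on these and on $\mu,s$, such that for every $\Lambda$ that is $d$-dimensional with volume constant $C$, every $D$, every $(\mu,s)$-local $H$, every $L>0$ and $|t|\le L/(4v_{LR})$: if $\phi_1,\dots,\phi_k$ have $(L/2,\,c_0e^{-\kappa_0L})$ topological order, then $e^{-iHt}\phi_1,\dots,e^{-iHt}\phi_k$ have $(L/4,\,c_1e^{-\kappa_1L})$ topological order. Thus topological order can be neither destroyed nor created in short times. -/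

import Mathlib

open scoped Matrix.Norms.L2Operator

noncomputable section

namespace SpinSystem

variable {Λ : Type*} [Fintype Λ] [DecidableEq Λ] {D : ℕ}

/-- The Hilbert space `⨂_{i ∈ Λ} ℂ^D` of a system with a `D`-dimensional space at each site,
in its product basis: the basis vectors are labelled by the configurations `Λ → Fin D`. -/
abbrev State (Λ : Type*) (D : ℕ) : Type _ := EuclideanSpace ℂ (Λ → Fin D)

/-- Operators on the Hilbert space of the system, as matrices in the product basis.
The norm is the operator norm induced by the Hilbert space norm. -/
abbrev Operator (Λ : Type*) (D : ℕ) : Type _ := Matrix (Λ → Fin D) (Λ → Fin D) ℂ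

/-- `O` is supported on `X`: `O = I_{Λ \ X} ⊗ P` for an operator `P` on the sites in `X`. -/
def SupportedOn (X : Finset Λ) (O : Operator Λ D) : Prop :=
  ∃ P : Matrix (X → Fin D) (X → Fin D) ℂ, ∀ x y : Λ → Fin D,
    O x y = if ∀ i, i ∉ X → x i = y i then P (fun i => x i) (fun i => y i) else 0

variable (Λ D) in
/-- A Hamiltonian `H = ∑_Z H_Z`, given with its decomposition into Hermitian terms `H_Z`
supported on `Z`. -/
structure Hamiltonian where
  term : Finset Λ → Operator Λ D
  isHermitian : ∀ Z, (term Z).IsHermitian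
  supportedOn : ∀ Z, SupportedOn Z (term Z)

/-- The operator `H = ∑_Z H_Z`. -/
def Hamiltonian.total (H : Hamiltonian Λ D) : Operator Λ D := ∑ Z : Finset Λ, H.term Z

/-- The evolution operator `exp (-i H t)`. -/
def Hamiltonian.evolution (H : Hamiltonian Λ D) (t : ℝ) : Operator Λ D :=
  NormedSpace.exp ((-(Complex.I * (t : ℂ))) • H.total)

/-- The Schrödinger evolution `exp (-i H t) φ` of a state. -/
def Hamiltonian.evolve (H : Hamiltonian Λ D) (t : ℝ) (φ : State Λ D) : State Λ D :=
  Matrix.toEuclideanLin (H.evolution t) φ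

/-- The Heisenberg evolution `O(t) = exp (i H t) O exp (-i H t)` of an operator. -/
def Hamiltonian.heisenberg (H : Hamiltonian Λ D) (t : ℝ) (O : Operator Λ D) : Operator Λ D :=
  H.evolution (-t) * O * H.evolution t

/-- Exponentially decaying interactions:
`∑_{Z ∋ i} ‖H_Z‖ |Z| exp (μ diam Z) ≤ s` for every site `i`. -/
def Hamiltonian.IsLocal [MetricSpace Λ] (H : Hamiltonian Λ D) (μ s : ℝ) : Prop :=
  ∀ i : Λ, ∑ Z : Finset Λ with i ∈ Z,
    ‖H.term Z‖ * (Z.card : ℝ) * Real.exp (μ * Metric.diam (Z : Set Λ)) ≤ s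

/-- `dist (X, Y) = min_{i ∈ X, j ∈ Y} dist (i, j)` (and `0` if `X` or `Y` is empty). -/
def setDist [MetricSpace Λ] (X Y : Finset Λ) : ℝ := ⨅ p : X × Y, dist (p.1 : Λ) (p.2 : Λ)

/-- The Lieb-Robinson bound with velocity `v` and tail function `g`: if `A` is supported on `X`,
`B` on `Y`, `r = dist (X, Y) > 0` and `|t| ≤ r / v`, then
`‖[A(t), B]‖ ≤ (v |t| / r) g(r) |X| ‖A‖ ‖B‖`. -/
def Hamiltonian.LiebRobinsonBound [MetricSpace Λ] (H : Hamiltonian Λ D) (v : ℝ) (g : ℝ → ℝ) :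
    Prop :=
  ∀ (X Y : Finset Λ) (A B : Operator Λ D), SupportedOn X A → SupportedOn Y B →
    0 < setDist X Y → ∀ t : ℝ, |t| ≤ setDist X Y / v →
      ‖H.heisenberg t A * B - B * H.heisenberg t A‖ ≤
        v * |t| / setDist X Y * g (setDist X Y) * (X.card : ℝ) * ‖A‖ * ‖B‖

/-- The matrix `M_{ab} = ⟨ψ_a, O ψ_b⟩`: the projection of `O` onto the span of the `ψ_a`. -/
def projected {k : ℕ} (ψ : Fin k → State Λ D) (O : Operator Λ D) : Matrix (Fin k) (Fin k) ℂ :=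
  Matrix.of fun a b => inner ℂ (ψ a) (Matrix.toEuclideanLin O (ψ b))

/-- The orthonormal states `ψ_a` have `(l, ε)` topological order: every operator `O` supported on
a set of diameter at most `l` projects to within `ε ‖O‖` of a multiple of the identity. -/
def TopologicalOrder [MetricSpace Λ] {k : ℕ} (ψ : Fin k → State Λ D) (l ε : ℝ) : Prop :=
  Orthonormal ℂ ψ ∧ ∀ (X : Finset Λ) (O : Operator Λ D), Metric.diam (X : Set Λ) ≤ l →
    SupportedOn X O → ∃ z : ℂ, ‖projected ψ O - z • (1 : Matrix (Fin k) (Fin k) ℂ)‖ ≤ ε * ‖O‖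

/-- `Λ` is (at most) `d`-dimensional with volume constant `C`: for `l ≥ 1`, a set of diameter at
most `l` has at most `C l^d` sites. -/
def VolumeBound (Λ : Type*) [MetricSpace Λ] (d : ℕ) (C : ℝ) : Prop :=
  ∀ (X : Finset Λ) (l : ℝ), 1 ≤ l → Metric.diam (X : Set Λ) ≤ l → (X.card : ℝ) ≤ C * l ^ d

/-- The product state `⨂_i u_i`; for `u_i = ↑` at every site it is `|↑↑↑…⟩`. -/
def productState (u : Λ → EuclideanSpace ℂ (Fin D)) : State Λ D :=
  WithLp.toLp 2 fun x => ∏ i, u i (x i)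

/-- `g` is nonnegative and decays exponentially. -/
def ExponentiallyDecaying (g : ℝ → ℝ) : Prop :=
  ∃ c κ : ℝ, 0 < c ∧ 0 < κ ∧ ∀ r : ℝ, 0 ≤ r → 0 ≤ g r ∧ g r ≤ c * Real.exp (-κ * r)

end SpinSystem

end

/-! Matrix elements of `O` in evolved states are matrix elements of the Heisenberg operator `O(t)`
in the original ones (`projected_evolve`). If `O(t)` is, up to a small error, supported on a slight
enlargement of the support of `O`, then order of the original states at the larger scale gives order
of the evolved states at the smaller scale (`TopologicalOrder.evolve`). Running time backwards gives
the converse.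

The spreading is controlled by a Lieb-Robinson bound. Terms of `H` disjoint from the support of `A`
commute with `A`, so `‖[A(t), B]‖` is bounded by its initial value plus an integral of the
commutators `[H_Z(u), B]` over the `Z` that meet the support (`norm_commutator_conj_le`). Locality
makes this inequality reproduce the weight `exp (-μ dist (i, Y))` with a factor `s`; iterating gives
`exp (2 s t) - 1` with a remainder `(2 s t)^n / n!` that tends to zero
(`norm_commutator_heisenberg_le_iterate`). An operator that almost commutes with every unitary
outside a region is close to its average over Pauli conjugations there, and that average is
supported on the region (`exists_supportedOn_norm_sub_le`).

A product state differs locally from every unit vector `χ` orthogonal to it: by a union bound for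
the commuting projections `|u_i⟩⟨u_i|`, some `1 - |u_i⟩⟨u_i|` has expectation at least `1 / |Λ|` in
`χ`, but `0` in the product state. For an evolved product state, the pair is first pulled back to
time zero. -/

set_option linter.unusedSectionVars false

noncomputable section

/-! ### One-parameter unitary groups in a C⋆-algebra -/

section Propagator

variable {𝔸 : Type*} [CStarAlgebra 𝔸]

/-- The one-parameter group `exp (-i h t)`. -/
def propagator (h : 𝔸) (t : ℝ) : 𝔸 := NormedSpace.exp ((-(Complex.I * (t : ℂ))) • h)

lemma propagator_add (h : 𝔸) (s t : ℝ) :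
    propagator h (s + t) = propagator h s * propagator h t := by
  let _ : NormedAlgebra ℚ 𝔸 := NormedAlgebra.restrictScalars ℚ ℂ 𝔸
  unfold propagator
  rw [← NormedSpace.exp_add_of_commute (((Commute.refl h).smul_left _).smul_right _), ← add_smul]
  congr 2
  push_cast
  ring

lemma propagator_zero (h : 𝔸) : propagator h 0 = 1 := by
  simp [propagator]

lemma propagator_neg_mul_self (h : 𝔸) (t : ℝ) : propagator h (-t) * propagator h t = 1 := by
  rw [← propagator_add, neg_add_cancel, propagator_zero]

lemma propagator_mul_neg_self (h : 𝔸) (t : ℝ) : propagator h t * propagator h (-t) = 1 := by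
  rw [← propagator_add, add_neg_cancel, propagator_zero]

lemma star_propagator {h : 𝔸} (hh : IsSelfAdjoint h) (t : ℝ) :
    star (propagator h t) = propagator h (-t) := by
  unfold propagator
  rw [NormedSpace.star_exp, star_smul, hh.star_eq]
  congr 2
  simp

lemma propagator_mem_unitary {h : 𝔸} (hh : IsSelfAdjoint h) (t : ℝ) :
    propagator h t ∈ unitary 𝔸 := by
  rw [Unitary.mem_iff, star_propagator hh]
  exact ⟨propagator_neg_mul_self h t, propagator_mul_neg_self h t⟩

lemma Commute.propagator_right {a h : 𝔸} (H : Commute a h) (t : ℝ) :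
    Commute a (propagator h t) := (H.smul_right _).exp_right

lemma propagator_neg_left (h : 𝔸) (t : ℝ) : propagator (-h) t = propagator h (-t) := by
  simp [propagator]

lemma hasDerivAt_propagator (h : 𝔸) (t : ℝ) :
    HasDerivAt (propagator h) ((-Complex.I) • (h * propagator h t)) t := by
  have h1 := hasDerivAt_exp_smul_const' (𝕂 := ℂ) h (-(Complex.I * (t : ℂ)))
  have h2 : HasDerivAt (fun u : ℝ => -(Complex.I * (u : ℂ))) (-Complex.I) t := by
    simpa using ((Complex.ofRealCLM.hasDerivAt (x := t)).const_mul Complex.I).fun_neg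
  exact h1.scomp t h2

lemma hasDerivAt_propagator_neg (h : 𝔸) (t : ℝ) :
    HasDerivAt (fun u => propagator h (-u)) (Complex.I • (propagator h (-t) * h)) t := by
  have h1 := hasDerivAt_propagator (-h) t
  simp only [propagator_neg_left] at h1
  have h2 : Commute h (propagator h (-t)) := (Commute.refl h).propagator_right _
  have h3 : propagator (-h) = fun u => propagator h (-u) := funext fun u => propagator_neg_left h u
  rw [h3] at h1
  convert h1 using 1
  rw [neg_mul, h2.eq, neg_smul, smul_neg, neg_neg]

lemma norm_propagator_conj {h : 𝔸} (hh : IsSelfAdjoint h) (t : ℝ) (a : 𝔸) :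
    ‖propagator h (-t) * a * propagator h t‖ = ‖a‖ := by
  rw [CStarRing.norm_mul_mem_unitary _ (propagator_mem_unitary hh t),
    CStarRing.norm_mem_unitary_mul _ (propagator_mem_unitary hh _)]

lemma norm_propagator_conj' {h : 𝔸} (hh : IsSelfAdjoint h) (t : ℝ) (a : 𝔸) :
    ‖propagator h t * a * propagator h (-t)‖ = ‖a‖ := by
  simpa using norm_propagator_conj hh (-t) a

lemma norm_commutator_le {R : Type*} [NormedRing R] (a b : R) :
    ‖a * b - b * a‖ ≤ 2 * ‖a‖ * ‖b‖ := by
  calc ‖a * b - b * a‖ ≤ ‖a * b‖ + ‖b * a‖ := norm_sub_le _ _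
    _ ≤ ‖a‖ * ‖b‖ + ‖b‖ * ‖a‖ := add_le_add (norm_mul_le _ _) (norm_mul_le _ _)
    _ = _ := by ring

/-- Moving a conjugation from one entry of a commutator to the other. -/
lemma norm_commutator_conj {h : 𝔸} (hh : IsSelfAdjoint h) (t : ℝ) (a b : 𝔸) :
    ‖propagator h (-t) * a * propagator h t * b - b * (propagator h (-t) * a * propagator h t)‖ =
      ‖a * (propagator h t * b * propagator h (-t)) -
        propagator h t * b * propagator h (-t) * a‖ := by
  rw [← norm_propagator_conj hh t (a * _ - _)]
  congr 1
  have e := propagator_neg_mul_self h t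
  have e1 : propagator h (-t) * (a * (propagator h t * b * propagator h (-t))) * propagator h t =
      propagator h (-t) * a * propagator h t * b * (propagator h (-t) * propagator h t) := by
    simp only [mul_assoc]
  have e2 : propagator h (-t) * (propagator h t * b * propagator h (-t) * a) * propagator h t =
      (propagator h (-t) * propagator h t) * (b * (propagator h (-t) * a * propagator h t)) := by
    simp only [mul_assoc]
  rw [mul_sub, sub_mul, e1, e2, e, mul_one, one_mul]

/-- The evolution of `b` relative to the evolution generated by `h₀`. -/
lemma hasDerivAt_interaction (h h₀ b : 𝔸) (t : ℝ) :
    HasDerivAt (fun u => propagator h₀ (-u) * (propagator h u * b * propagator h (-u)) *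
        propagator h₀ u)
      (propagator h₀ (-t) * ((-Complex.I) • ((h - h₀) * (propagator h t * b * propagator h (-t)) -
        propagator h t * b * propagator h (-t) * (h - h₀))) * propagator h₀ t) t := by
  have h1 := ((hasDerivAt_propagator_neg h₀ t).mul
    (((hasDerivAt_propagator h t).mul_const b).mul (hasDerivAt_propagator_neg h t))).mul
    (hasDerivAt_propagator h₀ t)
  refine h1.congr_deriv ?_
  simp only [smul_mul_assoc, mul_smul_comm, neg_smul, mul_add, add_mul, mul_sub, sub_mul,
    smul_sub, mul_neg, neg_mul, mul_assoc, Pi.mul_apply]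
  abel

/-- If `a` commutes with `h₀`, the commutator of the evolved `a` with `b` grows at most at the
rate set by the commutator of the evolved `h - h₀` with `b`. -/
theorem norm_commutator_conj_le {h h₀ a : 𝔸} (hh : IsSelfAdjoint h) (hh₀ : IsSelfAdjoint h₀)
    (ha : Commute a h₀) (b : 𝔸) {G G' : ℝ → ℝ} (hG₀ : G 0 = 0)
    (hG : ∀ u, HasDerivAt G (G' u) u) {t : ℝ} (ht : 0 ≤ t)
    (hb : ∀ u, 0 ≤ u →
      ‖propagator h (-u) * (h - h₀) * propagator h u * b -
        b * (propagator h (-u) * (h - h₀) * propagator h u)‖ ≤ G' u) :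
    ‖propagator h (-t) * a * propagator h t * b - b * (propagator h (-t) * a * propagator h t)‖ ≤
      ‖a * b - b * a‖ + 2 * ‖a‖ * G t := by
  set K : ℝ → 𝔸 := fun u => propagator h₀ (-u) * (propagator h u * b * propagator h (-u)) *
    propagator h₀ u with hK
  -- In the interaction picture the part `h₀` drops out: `K` starts at `b`, and its speed is the
  -- norm of the commutator of the evolved `h - h₀` with `b`.
  have hK' : ‖K t - b‖ ≤ G t := by
    have hd := fun u => (hasDerivAt_interaction h h₀ b u).sub_const b
    refine image_norm_le_of_norm_deriv_right_le_deriv_boundary (a := 0) (b := t)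
      (f := fun u => K u - b)
      (fun u _ => (hd u).continuousAt.continuousWithinAt)
      (fun u _ => (hd u).hasDerivWithinAt) ?_ hG ?_ ⟨ht, le_rfl⟩
    · simp [hK, propagator_zero, hG₀]
    · intro u hu
      rw [norm_propagator_conj hh₀, norm_smul, norm_neg, Complex.norm_I, one_mul,
        ← norm_commutator_conj hh]
      exact hb u hu.1
  have e : propagator h t * b * propagator h (-t) = propagator h₀ t * K t * propagator h₀ (-t) := by
    have e1 := propagator_mul_neg_self h₀ t
    calc _ = (propagator h₀ t * propagator h₀ (-t)) * (propagator h t * b * propagator h (-t)) *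
          (propagator h₀ t * propagator h₀ (-t)) := by rw [e1, one_mul, mul_one]
      _ = _ := by simp only [hK, mul_assoc]
  -- The remaining `h₀`-conjugation passes through `a`, so only the commutator of `a` with `K t`
  -- matters.
  have e2 : ∀ u, propagator h₀ u * a = a * propagator h₀ u :=
    fun u => (ha.propagator_right u).eq.symm
  have e3 : a * (propagator h₀ t * K t * propagator h₀ (-t)) -
      propagator h₀ t * K t * propagator h₀ (-t) * a =
      propagator h₀ t * (a * K t - K t * a) * propagator h₀ (-t) := by
    rw [mul_sub, sub_mul]
    congr 1
    · simp only [← mul_assoc, e2]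
    · simp only [mul_assoc, e2]
  rw [norm_commutator_conj hh, e, e3, norm_propagator_conj' hh₀]
  calc ‖a * K t - K t * a‖ = ‖(a * b - b * a) + (a * (K t - b) - (K t - b) * a)‖ := by
        congr 1; noncomm_ring
    _ ≤ ‖a * b - b * a‖ + 2 * ‖a‖ * ‖K t - b‖ :=
        (norm_add_le _ _).trans (add_le_add le_rfl (norm_commutator_le _ _))
    _ ≤ _ := by gcongr

end Propagator

end

noncomputable section

namespace SpinSystem

variable {Λ : Type*} [Fintype Λ] [DecidableEq Λ] {D : ℕ}

/-! ### Operators supported on a set of sites -/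

lemma SupportedOn.apply_eq_zero {X : Finset Λ} {O : Operator Λ D} (h : SupportedOn X O)
    {x y : Λ → Fin D} {i : Λ} (hi : i ∉ X) (hxy : x i ≠ y i) : O x y = 0 := by
  obtain ⟨P, hP⟩ := h
  rw [hP, if_neg fun H => hxy (H i hi)]

lemma SupportedOn.apply_congr {X : Finset Λ} {O : Operator Λ D} (h : SupportedOn X O)
    {x y x' y' : Λ → Fin D} (hx : ∀ i ∈ X, x i = x' i) (hy : ∀ i ∈ X, y i = y' i)
    (hxy : ∀ i ∉ X, (x i = y i ↔ x' i = y' i)) : O x y = O x' y' := by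
  obtain ⟨P, hP⟩ := h
  have e1 : (fun i : X => x i) = fun i : X => x' i := funext fun i => hx i i.2
  have e2 : (fun i : X => y i) = fun i : X => y' i := funext fun i => hy i i.2
  rw [hP, hP, e1, e2]
  have : (∀ i, i ∉ X → x i = y i) ↔ ∀ i, i ∉ X → x' i = y' i :=
    forall₂_congr hxy
  simp only [this]

lemma supportedOn_univ (O : Operator Λ D) : SupportedOn Finset.univ O :=
  ⟨fun p q => O (fun i => p ⟨i, Finset.mem_univ i⟩) (fun i => q ⟨i, Finset.mem_univ i⟩),
    fun x y => by simp⟩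

lemma SupportedOn.neg {X : Finset Λ} {O : Operator Λ D} (h : SupportedOn X O) :
    SupportedOn X (-O) := by
  obtain ⟨P, hP⟩ := h
  refine ⟨-P, fun x y => ?_⟩
  rw [Matrix.neg_apply, hP]
  split_ifs <;> simp

lemma supportedOn_one (X : Finset Λ) : SupportedOn X (1 : Operator Λ D) := by
  refine ⟨1, fun x y => ?_⟩
  rw [Matrix.one_apply, Matrix.one_apply]
  by_cases h : x = y
  · subst h; simp
  · rw [if_neg h]
    split_ifs with h1 h2
    · refine absurd (funext fun i => ?_) h
      by_cases hi : i ∈ X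
      · exact congr_fun h2 ⟨i, hi⟩
      · exact h1 i hi
    · rfl
    · rfl

/-- Operators with disjoint supports commute. -/
theorem SupportedOn.commute {X Y : Finset Λ} {A B : Operator Λ D} (hA : SupportedOn X A)
    (hB : SupportedOn Y B) (hXY : Disjoint X Y) : Commute A B := by
  ext x y
  have hYX : ∀ i ∈ Y, i ∉ X := fun i hi hi' => Finset.disjoint_left.mp hXY hi' hi
  have hXY' : ∀ i ∈ X, i ∉ Y := fun i hi => Finset.disjoint_left.mp hXY hi
  -- Only one intermediate configuration contributes to each product: `A` freezes the sites outside
  -- `X` and `B` freezes those in `X`.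
  rw [Matrix.mul_apply, Matrix.mul_apply, Finset.sum_eq_single (X.piecewise y x),
    Finset.sum_eq_single (X.piecewise x y), mul_comm]
  · congr 1
    · apply hB.apply_congr
      · intro i hi; simp [hYX i hi]
      · intro i hi; simp [hYX i hi]
      · intro i hi
        by_cases h : i ∈ X <;> simp [h]
    · apply hA.apply_congr
      · intro i hi; simp [hi]
      · intro i hi; simp [hi]
      · intro i hi; simp [hi]
  · intro z _ hz
    obtain ⟨i, hi⟩ := Function.ne_iff.mp hz
    by_cases h : i ∈ X
    · rw [Finset.piecewise_eq_of_mem _ _ _ h] at hi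
      rw [hB.apply_eq_zero (hXY' i h) (Ne.symm hi), zero_mul]
    · rw [Finset.piecewise_eq_of_notMem _ _ _ h] at hi
      rw [hA.apply_eq_zero h hi, mul_zero]
  · simp
  · intro z _ hz
    obtain ⟨i, hi⟩ := Function.ne_iff.mp hz
    by_cases h : i ∈ X
    · rw [Finset.piecewise_eq_of_mem _ _ _ h] at hi
      rw [hB.apply_eq_zero (hXY' i h) hi, mul_zero]
    · rw [Finset.piecewise_eq_of_notMem _ _ _ h] at hi
      rw [hA.apply_eq_zero h (Ne.symm hi), zero_mul]
  · simp

/-! ### Averaging over shifts and phases -/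

section Twirl

variable [NeZero D]

/-- The restriction of a configuration to `Y`, extended by `0`. -/
def cutoff (Y : Finset Λ) (x : Λ → Fin D) : Λ → Fin D := fun i => if i ∈ Y then x i else 0

lemma cutoff_sub (Y : Finset Λ) (x y : Λ → Fin D) :
    cutoff Y (x - y) = cutoff Y x - cutoff Y y := by
  funext i
  by_cases h : i ∈ Y <;> simp [cutoff, h]

lemma cutoff_add (Y : Finset Λ) (x y : Λ → Fin D) :
    cutoff Y (x + y) = cutoff Y x + cutoff Y y := by
  funext i
  by_cases h : i ∈ Y <;> simp [cutoff, h]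

/-- The generalised Pauli operator on `Y`: a shift by `a` followed by the phases `χ`. -/
def pauli (Y : Finset Λ) (χ : AddChar (Λ → Fin D) ℂ) (a : Λ → Fin D) : Operator Λ D :=
  Matrix.of fun x y => if y = x - cutoff Y a then χ (cutoff Y x) else 0

lemma supportedOn_pauli (Y : Finset Λ) (χ : AddChar (Λ → Fin D) ℂ) (a : Λ → Fin D) :
    SupportedOn Y (pauli Y χ a) := by
  refine ⟨fun p q => if ∀ i : Y, q i = p i - a i then
    χ (fun i => if h : i ∈ Y then p ⟨i, h⟩ else 0) else 0, fun x y => ?_⟩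
  have e : (fun i => if h : i ∈ Y then x i else 0) = cutoff Y x := by
    funext i; simp [cutoff]
  simp only [pauli, Matrix.of_apply, e, ← ite_and]
  congr 1
  rw [funext_iff, eq_iff_iff]
  constructor
  · intro h
    exact ⟨fun i hi => by simpa [cutoff, hi] using (h i).symm,
      fun i => by simpa [cutoff] using h i⟩
  · rintro ⟨h1, h2⟩ i
    by_cases hi : i ∈ Y
    · simpa [cutoff, hi] using h2 ⟨i, hi⟩
    · simpa [cutoff, hi] using (h1 i hi).symm

lemma pauli_mul_apply (Y : Finset Λ) (χ : AddChar (Λ → Fin D) ℂ) (a : Λ → Fin D)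
    (O : Operator Λ D) (x y : Λ → Fin D) :
    (pauli Y χ a * O) x y = χ (cutoff Y x) * O (x - cutoff Y a) y := by
  simp [Matrix.mul_apply, pauli]

lemma pauli_conj_apply (Y : Finset Λ) (χ : AddChar (Λ → Fin D) ℂ) (a : Λ → Fin D)
    (O : Operator Λ D) (x y : Λ → Fin D) :
    (pauli Y χ a * O * star (pauli Y χ a)) x y =
      χ (cutoff Y (x - y)) * O (x - cutoff Y a) (y - cutoff Y a) := by
  rw [Matrix.mul_apply, Finset.sum_eq_single (y - cutoff Y a)]
  · rw [pauli_mul_apply, Matrix.star_apply, pauli, Matrix.of_apply, if_pos rfl, cutoff_sub,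
      sub_eq_add_neg (cutoff Y x), AddChar.map_add_eq_mul, AddChar.map_neg_eq_conj]
    simp only [starRingEnd_apply]
    ring
  · intro z _ hz
    rw [Matrix.star_apply, pauli, Matrix.of_apply, if_neg hz, star_zero, mul_zero]
  · simp

lemma pauli_mem_unitary (Y : Finset Λ) (χ : AddChar (Λ → Fin D) ℂ) (a : Λ → Fin D) :
    pauli Y χ a ∈ unitary (Operator Λ D) := by
  have h : pauli Y χ a * star (pauli Y χ a) = 1 := by
    ext x y
    have := pauli_conj_apply Y χ a 1 x y
    rw [mul_one] at this
    rw [this, Matrix.one_apply, Matrix.one_apply]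
    by_cases hxy : x = y
    · subst hxy
      have : cutoff Y (0 : Λ → Fin D) = 0 := by funext i; simp [cutoff]
      simp [this]
    · simp [hxy]
  exact Unitary.mem_iff.mpr ⟨mul_eq_one_comm.mp h, h⟩

/-- The average of `O` over conjugations by Pauli operators on `Y`. -/
def twirl (Y : Finset Λ) (O : Operator Λ D) : Operator Λ D :=
  ((Fintype.card (AddChar (Λ → Fin D) ℂ × (Λ → Fin D)) : ℂ))⁻¹ •
    ∑ p : AddChar (Λ → Fin D) ℂ × (Λ → Fin D),
      pauli Y p.1 p.2 * O * star (pauli Y p.1 p.2)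

/-- Orthogonality of characters turns the phase average into a Kronecker delta on `Y`. Phases and
shifts range over all of `Λ`, which only repeats each Pauli operator on `Y` equally often. -/
lemma twirl_apply (Y : Finset Λ) (O : Operator Λ D) (x y : Λ → Fin D) :
    twirl Y O x y = (Fintype.card (AddChar (Λ → Fin D) ℂ × (Λ → Fin D)) : ℂ)⁻¹ *
      ((if cutoff Y (x - y) = 0 then (Fintype.card (Λ → Fin D) : ℂ) else 0) *
        ∑ a : Λ → Fin D, O (x - cutoff Y a) (y - cutoff Y a)) := by
  simp only [twirl, Matrix.smul_apply, Matrix.sum_apply, pauli_conj_apply, smul_eq_mul]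
  rw [Fintype.sum_prod_type, ← AddChar.sum_apply_eq_ite, Finset.sum_mul_sum]

lemma supportedOn_twirl (Y : Finset Λ) (O : Operator Λ D) : SupportedOn Yᶜ (twirl Y O) := by
  set c := (Fintype.card (AddChar (Λ → Fin D) ℂ × (Λ → Fin D)) : ℂ)⁻¹
  refine ⟨fun p q => c * (Fintype.card (Λ → Fin D) * ∑ a : Λ → Fin D,
    O ((fun i => if h : i ∈ Yᶜ then p ⟨i, h⟩ else 0) - cutoff Y a)
      ((fun i => if h : i ∈ Yᶜ then q ⟨i, h⟩ else 0) - cutoff Y a)), fun x y => ?_⟩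
  have hc : cutoff Y (x - y) = 0 ↔ ∀ i, i ∉ Yᶜ → x i = y i := by
    rw [funext_iff]
    refine forall_congr' fun i => ?_
    by_cases hi : i ∈ Y <;> simp [cutoff, hi, sub_eq_zero]
  have he : ∀ z : Λ → Fin D, (fun i => if h : i ∈ Yᶜ then z i else 0) = z - cutoff Y z := by
    intro z
    funext i
    by_cases hi : i ∈ Y <;> simp [cutoff, hi]
  rw [twirl_apply]
  simp only [hc, he]
  split_ifs with h
  · congr 2
    have hy : cutoff Y y = cutoff Y x := by
      have := hc.mpr h
      rw [cutoff_sub, sub_eq_zero] at this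
      exact this.symm
    -- Translating the summation variable by `x` absorbs the common values of `x` and `y` on `Y`, so
    -- the entry no longer depends on them.
    rw [hy, ← Equiv.sum_comp (Equiv.addLeft x)]
    simp only [Equiv.coe_addLeft, cutoff_add, sub_sub]
  · simp

lemma norm_twirl_le (Y : Finset Λ) (O : Operator Λ D) : ‖twirl Y O‖ ≤ ‖O‖ := by
  rw [twirl, norm_smul, norm_inv, Complex.norm_natCast,
    inv_mul_le_iff₀ (Nat.cast_pos.mpr Fintype.card_pos)]
  refine (norm_sum_le _ _).trans ((Finset.sum_le_card_nsmul _ _ ‖O‖ fun p _ => ?_).trans ?_)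
  · have h := pauli_mem_unitary Y p.1 p.2
    rw [CStarRing.norm_mul_mem_unitary _ (Unitary.star_mem h), CStarRing.norm_mem_unitary_mul _ h]
  · simp

/-- Each term of the average differs from `O` by `O - U O U* = [O, U] U*`, whose norm is that of the
commutator. -/
lemma norm_sub_twirl_le (Y : Finset Λ) (O : Operator Λ D) {δ : ℝ}
    (h : ∀ W ∈ unitary (Operator Λ D), SupportedOn Y W → ‖O * W - W * O‖ ≤ δ) :
    ‖O - twirl Y O‖ ≤ δ := by
  have hc : (0 : ℝ) < Fintype.card (AddChar (Λ → Fin D) ℂ × (Λ → Fin D)) :=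
    Nat.cast_pos.mpr Fintype.card_pos
  have hc' : (Fintype.card (AddChar (Λ → Fin D) ℂ × (Λ → Fin D)) : ℂ) ≠ 0 :=
    Nat.cast_ne_zero.mpr Fintype.card_ne_zero
  have e : O - twirl Y O =
      ((Fintype.card (AddChar (Λ → Fin D) ℂ × (Λ → Fin D)) : ℂ))⁻¹ •
        ∑ p : AddChar (Λ → Fin D) ℂ × (Λ → Fin D),
          (O * pauli Y p.1 p.2 - pauli Y p.1 p.2 * O) * star (pauli Y p.1 p.2) := by
    have : ∀ p : AddChar (Λ → Fin D) ℂ × (Λ → Fin D),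
        (O * pauli Y p.1 p.2 - pauli Y p.1 p.2 * O) * star (pauli Y p.1 p.2) =
          O - pauli Y p.1 p.2 * O * star (pauli Y p.1 p.2) := fun p => by
      rw [sub_mul, mul_assoc O, Unitary.mul_star_self_of_mem (pauli_mem_unitary Y p.1 p.2),
        mul_one]
    rw [Finset.sum_congr rfl fun p _ => this p, Finset.sum_sub_distrib, smul_sub, Finset.sum_const,
      Finset.card_univ, ← Nat.cast_smul_eq_nsmul ℂ, smul_smul, inv_mul_cancel₀ hc', one_smul, twirl]
  rw [e, norm_smul, norm_inv, Complex.norm_natCast, inv_mul_le_iff₀ hc]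
  refine (norm_sum_le _ _).trans ((Finset.sum_le_card_nsmul _ _ δ fun p _ => ?_).trans ?_)
  · have h' := pauli_mem_unitary Y p.1 p.2
    rw [CStarRing.norm_mul_mem_unitary _ (Unitary.star_mem h')]
    exact h _ h' (supportedOn_pauli _ _ _)
  · simp

end Twirl

/-- An operator that almost commutes with all unitaries on the complement of `X` is close to an
operator supported on `X`. -/
theorem exists_supportedOn_norm_sub_le (X : Finset Λ) (O : Operator Λ D) {δ : ℝ} (hδ : 0 ≤ δ)
    (h : ∀ W ∈ unitary (Operator Λ D), SupportedOn Xᶜ W → ‖O * W - W * O‖ ≤ δ) :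
    ∃ O' : Operator Λ D, SupportedOn X O' ∧ ‖O'‖ ≤ ‖O‖ ∧ ‖O - O'‖ ≤ δ := by
  -- The shifts need an element `0 : Fin D`. For `D = 0` either there are no sites or there are no
  -- configurations, and `O` itself serves.
  rcases Nat.eq_zero_or_pos D with rfl | hD
  · refine ⟨O, ?_, le_rfl, by simpa using hδ⟩
    rcases isEmpty_or_nonempty Λ with hΛ | ⟨⟨i⟩⟩
    · rw [Finset.eq_univ_of_forall (s := X) fun i => isEmptyElim i]
      exact supportedOn_univ O
    · exact ⟨0, fun x => (x i).elim0⟩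
  · have : NeZero D := ⟨hD.ne'⟩
    refine ⟨twirl Xᶜ O, ?_, norm_twirl_le _ _, norm_sub_twirl_le _ _ h⟩
    simpa using supportedOn_twirl Xᶜ O

end SpinSystem
end

noncomputable section

namespace SpinSystem

variable {Λ : Type*} [Fintype Λ] [DecidableEq Λ] {D : ℕ}

/-! ### The Lieb-Robinson bound -/

lemma Hamiltonian.isSelfAdjoint_total (H : Hamiltonian Λ D) : IsSelfAdjoint H.total :=
  isSelfAdjoint_sum _ fun Z _ => H.isHermitian Z

lemma Hamiltonian.evolution_eq_propagator (H : Hamiltonian Λ D) (t : ℝ) :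
    H.evolution t = propagator H.total t := rfl

lemma Hamiltonian.heisenberg_eq (H : Hamiltonian Λ D) (t : ℝ) (O : Operator Λ D) :
    H.heisenberg t O = propagator H.total (-t) * O * propagator H.total t := rfl

lemma Hamiltonian.norm_heisenberg (H : Hamiltonian Λ D) (t : ℝ) (O : Operator Λ D) :
    ‖H.heisenberg t O‖ = ‖O‖ :=
  norm_propagator_conj H.isSelfAdjoint_total t O

lemma Hamiltonian.heisenberg_sum (H : Hamiltonian Λ D) (t : ℝ) {ι : Type*} (S : Finset ι)
    (O : ι → Operator Λ D) : H.heisenberg t (∑ i ∈ S, O i) = ∑ i ∈ S, H.heisenberg t (O i) := by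
  simp only [Hamiltonian.heisenberg, Finset.mul_sum, Finset.sum_mul]

/-- The Hamiltonian `-H`. -/
def Hamiltonian.neg (H : Hamiltonian Λ D) : Hamiltonian Λ D where
  term Z := -H.term Z
  isHermitian Z := (H.isHermitian Z).neg
  supportedOn Z := (H.supportedOn Z).neg

lemma Hamiltonian.heisenberg_neg (H : Hamiltonian Λ D) (t : ℝ) (O : Operator Λ D) :
    H.neg.heisenberg t O = H.heisenberg (-t) O := by
  have : H.neg.total = -H.total := by simp [Hamiltonian.total, Hamiltonian.neg]
  rw [heisenberg_eq, heisenberg_eq, this, propagator_neg_left, propagator_neg_left]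

lemma Hamiltonian.IsLocal.neg [MetricSpace Λ] {H : Hamiltonian Λ D} {μ s : ℝ}
    (h : H.IsLocal μ s) : H.neg.IsLocal μ s := by
  intro i
  simpa [Hamiltonian.neg] using h i

lemma commutator_heisenberg_eq_zero_of_isEmpty_left (H : Hamiltonian Λ D) {A : Operator Λ D}
    (hA : SupportedOn ∅ A) (B : Operator Λ D) (t : ℝ) :
    H.heisenberg t A * B - B * H.heisenberg t A = 0 := by
  have hc : ∀ C : Operator Λ D, Commute A C := fun C =>
    hA.commute (supportedOn_univ C) (Finset.disjoint_empty_left _)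
  have : H.heisenberg t A = A := by
    rw [H.heisenberg_eq, ← (hc _).eq, mul_assoc, propagator_neg_mul_self, mul_one]
  rw [this, (hc B).eq, sub_self]

lemma commutator_eq_zero_of_isEmpty_right {B : Operator Λ D} (hB : SupportedOn ∅ B)
    (A : Operator Λ D) : A * B - B * A = 0 := by
  rw [(hB.commute (supportedOn_univ A) (Finset.disjoint_empty_left _)).eq, sub_self]

section Metric

variable [MetricSpace Λ]

/-- Summing the interaction terms that meet `X` against a function `f` of the support. -/
lemma Hamiltonian.IsLocal.sum_meeting_le {H : Hamiltonian Λ D} {μ s : ℝ} (h : H.IsLocal μ s)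
    (X : Finset Λ) {f : Finset Λ → ℝ} {b : Λ → ℝ} (hf : ∀ Z, 0 ≤ f Z) (hb : ∀ i, 0 ≤ b i)
    (hfb : ∀ Z, ∀ i ∈ Z, f Z ≤ (Z.card : ℝ) * Real.exp (μ * Metric.diam (Z : Set Λ)) * b i) :
    ∑ Z : Finset Λ with ¬Disjoint Z X, ‖H.term Z‖ * f Z ≤ s * ∑ i ∈ X, b i := by
  calc ∑ Z : Finset Λ with ¬Disjoint Z X, ‖H.term Z‖ * f Z
      ≤ ∑ Z : Finset Λ, ∑ i ∈ X, if i ∈ Z then ‖H.term Z‖ * f Z else 0 := by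
        rw [Finset.sum_filter]
        refine Finset.sum_le_sum fun Z _ => ?_
        have h0 : ∀ i ∈ X, (0 : ℝ) ≤ if i ∈ Z then ‖H.term Z‖ * f Z else 0 := fun i _ => by
          have := hf Z
          split_ifs <;> positivity
        by_cases hZ : Disjoint Z X
        · simpa [hZ] using Finset.sum_nonneg h0
        · obtain ⟨i, hiZ, hiX⟩ := Finset.not_disjoint_iff.mp hZ
          refine le_trans ?_ (Finset.single_le_sum h0 hiX)
          simp [hiZ, hZ]
    _ = ∑ i ∈ X, ∑ Z : Finset Λ with i ∈ Z, ‖H.term Z‖ * f Z := by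
        rw [Finset.sum_comm]
        simp only [Finset.sum_filter]
    _ ≤ ∑ i ∈ X, s * b i := by
        refine Finset.sum_le_sum fun i _ => ?_
        refine le_trans ?_ (mul_le_mul_of_nonneg_right (h i) (hb i))
        rw [Finset.sum_mul]
        refine Finset.sum_le_sum fun Z hZ => ?_
        have := hfb Z i (Finset.mem_filter.mp hZ).2
        calc _ ≤ ‖H.term Z‖ * ((Z.card : ℝ) * Real.exp (μ * Metric.diam (Z : Set Λ)) * b i) := by
              gcongr
          _ = _ := by ring
    _ = s * ∑ i ∈ X, b i := by rw [Finset.mul_sum]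

/-- The Lieb-Robinson bound after `n` iterations of `norm_commutator_conj_le`, for a weight `a`
that is at least `1` on `Y` and varies by a factor of at most `exp (μ diam Z)` on any set `Z`. -/
theorem norm_commutator_heisenberg_le_iterate {H : Hamiltonian Λ D} {μ s : ℝ} (hμ : 0 ≤ μ)
    (h : H.IsLocal μ s) {Y : Finset Λ} {B : Operator Λ D} (hB : SupportedOn Y B) {a : Λ → ℝ}
    (ha : ∀ i, 0 ≤ a i) (haY : ∀ i ∈ Y, 1 ≤ a i)
    (haZ : ∀ Z : Finset Λ, ∀ i ∈ Z, ∀ j ∈ Z, a j ≤ Real.exp (μ * Metric.diam (Z : Set Λ)) * a i)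
    (hs : 0 ≤ s) (n : ℕ) (X : Finset Λ) (A : Operator Λ D) (hA : SupportedOn X A) (t : ℝ)
    (ht : 0 ≤ t) :
    ‖H.heisenberg t A * B - B * H.heisenberg t A‖ ≤ 2 * ‖A‖ * ‖B‖ *
      ((if Disjoint X Y then 0 else 1) + (∑ i ∈ X, a i) * (Real.exp (2 * s * t) - 1) +
        (X.card : ℝ) * ((2 * s * t) ^ n / n.factorial)) := by
  have hexp : ∀ {u : ℝ}, 0 ≤ u → 0 ≤ Real.exp (2 * s * u) - 1 := fun hu =>
    sub_nonneg.mpr (Real.one_le_exp (by positivity))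
  have hone : ∀ Z : Finset Λ, 1 ≤ Real.exp (μ * Metric.diam (Z : Set Λ)) := fun Z =>
    Real.one_le_exp (mul_nonneg hμ Metric.diam_nonneg)
  have hw : ∀ Z : Finset Λ, 0 ≤ ∑ i ∈ Z, a i := fun Z => Finset.sum_nonneg fun i _ => ha i
  have hI : ∀ Z : Finset Λ, (0 : ℝ) ≤ if Disjoint Z Y then 0 else 1 := fun Z => by
    split_ifs <;> norm_num
  induction n generalizing X A t with
  | zero =>
    -- The trivial bound `2 ‖A‖ ‖B‖` is covered by the remainder `|X|` only when `X` is nonempty;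
    -- operators supported on `∅` are central.
    rcases X.eq_empty_or_nonempty with rfl | hX
    · rw [commutator_heisenberg_eq_zero_of_isEmpty_left H hA]
      simp
    · refine (norm_commutator_le _ _).trans ?_
      rw [H.norm_heisenberg]
      refine le_mul_of_one_le_right (by positivity) ?_
      have h1 : (1 : ℝ) ≤ X.card := by exact_mod_cast hX.card_pos
      have := mul_nonneg (hw X) (hexp ht)
      simp only [pow_zero, Nat.factorial_zero, Nat.cast_one, div_one, mul_one]
      linarith [hI X]
  | succ n ih =>
    set S : Finset (Finset Λ) := Finset.univ.filter fun Z => ¬Disjoint Z X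
    set h₀ : Operator Λ D := ∑ Z : Finset Λ with Disjoint Z X, H.term Z
    have hsub : H.total - h₀ = ∑ Z ∈ S, H.term Z := by
      rw [sub_eq_iff_eq_add', Hamiltonian.total]
      exact (Finset.sum_filter_add_sum_filter_not _ _ _).symm
    have hcomm : Commute A h₀ := Commute.sum_right _ _ _ fun Z hZ =>
      hA.commute (H.supportedOn Z) (Finset.mem_filter.mp hZ).2.symm
    have hh₀ : IsSelfAdjoint h₀ := isSelfAdjoint_sum _ fun Z _ => H.isHermitian Z
    set w := ∑ i ∈ X, a i
    -- `G'` is the induction hypothesis summed over the terms meeting `X`. Its constant part `s * w`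
    -- comes from the terms meeting `Y`, and with the exponential part it integrates to `w * (exp (2
    -- s u) - 1)`.
    have key := norm_commutator_conj_le H.isSelfAdjoint_total hh₀ hcomm B
      (G := fun u => ‖B‖ * (w * (Real.exp (2 * s * u) - 1) +
        (X.card : ℝ) * ((2 * s * u) ^ (n + 1) / (n + 1).factorial)))
      (G' := fun u => 2 * ‖B‖ * (s * w + s * w * (Real.exp (2 * s * u) - 1) +
        s * (X.card : ℝ) * ((2 * s * u) ^ n / n.factorial)))
      (by simp) (fun u => ?_) ht (fun u hu => ?_)
    · refine key.trans ?_
      have hAB : ‖A * B - B * A‖ ≤ 2 * ‖A‖ * ‖B‖ * (if Disjoint X Y then 0 else 1) := by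
        split_ifs with hXY
        · rw [(hA.commute hB hXY).eq]; simp
        · simpa using norm_commutator_le A B
      calc _ ≤ 2 * ‖A‖ * ‖B‖ * (if Disjoint X Y then 0 else 1) + _ := add_le_add hAB le_rfl
        _ = _ := by ring
    · have h1 : HasDerivAt (fun u : ℝ => 2 * s * u) (2 * s) u := by
        simpa using (hasDerivAt_id u).const_mul (2 * s)
      have h2 := (((h1.exp.sub_const 1).const_mul w).add
        (((h1.pow (n + 1)).div_const ((n + 1).factorial : ℝ)).const_mul (X.card : ℝ))).const_mul ‖B‖
      refine h2.congr_deriv ?_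
      have : ((n : ℝ) + 1) ≠ 0 := by positivity
      have : (n.factorial : ℝ) ≠ 0 := by positivity
      rw [Nat.factorial_succ]
      push_cast
      field_simp
      ring
    · rw [hsub]
      have e := H.heisenberg_sum u S H.term
      rw [H.heisenberg_eq] at e
      rw [e, Finset.sum_mul, Finset.mul_sum, ← Finset.sum_sub_distrib]
      set p := (2 * s * u) ^ n / (n.factorial : ℝ)
      have hp : 0 ≤ p := by positivity
      have hq := hexp hu
      -- The three parts of the induction hypothesis are summed separately: `b1` spends only the
      -- exponential, `b2` both it and the factor `|Z|`, and `b3` only `|Z|`.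
      have b1 := h.sum_meeting_le X hI ha fun Z i hi => by
        have hc : (1 : ℝ) ≤ Z.card := by exact_mod_cast Finset.card_pos.mpr ⟨i, hi⟩
        have hnn : 0 ≤ Real.exp (μ * Metric.diam (Z : Set Λ)) * a i :=
          mul_nonneg (Real.exp_nonneg _) (ha i)
        split_ifs with hZ
        · rw [mul_assoc]; positivity
        · obtain ⟨j, hjZ, hjY⟩ := Finset.not_disjoint_iff.mp hZ
          rw [mul_assoc]
          calc (1 : ℝ) ≤ Real.exp (μ * Metric.diam (Z : Set Λ)) * a i :=
                (haY j hjY).trans (haZ Z i hi j hjZ)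
            _ ≤ _ := le_mul_of_one_le_left hnn hc
      have b2 := h.sum_meeting_le X hw ha fun Z i hi => by
        rw [mul_assoc, ← nsmul_eq_mul]
        exact Finset.sum_le_card_nsmul _ _ _ fun j hj => haZ Z i hi j hj
      have b3 := h.sum_meeting_le X (f := fun Z => (Z.card : ℝ)) (b := fun _ => 1)
        (fun _ => by positivity) (fun _ => zero_le_one) fun Z i hi => by
          rw [mul_one]
          exact le_mul_of_one_le_right (by positivity) (hone Z)
      calc _ ≤ ∑ Z ∈ S, 2 * ‖H.term Z‖ * ‖B‖ * ((if Disjoint Z Y then 0 else 1) +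
            (∑ i ∈ Z, a i) * (Real.exp (2 * s * u) - 1) + (Z.card : ℝ) * p) :=
            (norm_sum_le _ _).trans (Finset.sum_le_sum fun Z _ => ih Z _ (H.supportedOn Z) u hu)
        _ = 2 * ‖B‖ * ((∑ Z ∈ S, ‖H.term Z‖ * (if Disjoint Z Y then 0 else 1)) +
            (∑ Z ∈ S, ‖H.term Z‖ * ∑ i ∈ Z, a i) * (Real.exp (2 * s * u) - 1) +
            (∑ Z ∈ S, ‖H.term Z‖ * (Z.card : ℝ)) * p) := by
            rw [Finset.sum_mul, Finset.sum_mul, ← Finset.sum_add_distrib,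
              ← Finset.sum_add_distrib, Finset.mul_sum]
            refine Finset.sum_congr rfl fun Z _ => ?_
            ring
        _ ≤ _ := by
            simp only [Finset.sum_const, nsmul_eq_mul, mul_one] at b3
            gcongr

/-- The Lieb-Robinson bound for operators with disjoint supports at distance at least `r`. -/
theorem norm_commutator_heisenberg_le {H : Hamiltonian Λ D} {μ s : ℝ} (hμ : 0 ≤ μ) (hs : 0 ≤ s)
    (h : H.IsLocal μ s) {X Y : Finset Λ} {A B : Operator Λ D} (hA : SupportedOn X A)
    (hB : SupportedOn Y B) (hdisj : Disjoint X Y) {r : ℝ} (hXY : ∀ i ∈ X, ∀ j ∈ Y, r ≤ dist i j)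
    (t : ℝ) :
    ‖H.heisenberg t A * B - B * H.heisenberg t A‖ ≤
      2 * ‖A‖ * ‖B‖ * ((X.card : ℝ) * Real.exp (-μ * r) * (Real.exp (2 * s * |t|) - 1)) := by
  wlog ht : 0 ≤ t generalizing H t
  · have := this h.neg (-t) (by linarith)
    rwa [H.heisenberg_neg, neg_neg, abs_neg] at this
  have hexp : 0 ≤ Real.exp (2 * s * |t|) - 1 :=
    sub_nonneg.mpr (Real.one_le_exp (by positivity))
  rcases Y.eq_empty_or_nonempty with rfl | hY
  · rw [commutator_eq_zero_of_isEmpty_right hB, norm_zero]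
    positivity
  set a : Λ → ℝ := fun i => Real.exp (-μ * Metric.infDist i (Y : Set Λ))
  have hlim : ‖H.heisenberg t A * B - B * H.heisenberg t A‖ ≤ 2 * ‖A‖ * ‖B‖ *
      (0 + (∑ i ∈ X, a i) * (Real.exp (2 * s * t) - 1) + (X.card : ℝ) * 0) := by
    -- Letting the number of iterations tend to infinity removes the remainder.
    refine ge_of_tendsto' (tendsto_const_nhds.mul (tendsto_const_nhds.add
      (tendsto_const_nhds.mul (FloorSemiring.tendsto_pow_div_factorial_atTop (2 * s * t)))))
      fun n => ?_
    have := norm_commutator_heisenberg_le_iterate hμ h hB (a := a) (fun i => Real.exp_nonneg _)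
      (fun i hi => by simp [a, Metric.infDist_zero_of_mem (Finset.mem_coe.mpr hi)])
      (fun Z i hi j hj => ?_) hs n X A hA t ht
    · rwa [if_pos hdisj] at this
    · rw [← Real.exp_add]
      refine Real.exp_le_exp.mpr ?_
      have h1 : Metric.infDist i (Y : Set Λ) ≤ Metric.infDist j (Y : Set Λ) + dist i j :=
        Metric.infDist_le_infDist_add_dist
      have h2 : dist i j ≤ Metric.diam (Z : Set Λ) :=
        Metric.dist_le_diam_of_mem Z.finite_toSet.isBounded hi hj
      nlinarith
  rw [zero_add, mul_zero, add_zero] at hlim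
  rw [abs_of_nonneg ht] at hexp ⊢
  refine hlim.trans ?_
  gcongr
  rw [← nsmul_eq_mul]
  refine Finset.sum_le_card_nsmul _ _ _ fun i hi => Real.exp_le_exp.mpr ?_
  have : r ≤ Metric.infDist i (Y : Set Λ) :=
    (Metric.le_infDist (Finset.coe_nonempty.mpr hY)).mpr fun {j} hj => hXY i hi j hj
  nlinarith

/-- The Lieb-Robinson bound with velocity `8 s / μ` and tail `2 exp (-(μ / 4) r)`. -/
theorem Hamiltonian.IsLocal.liebRobinsonBound {H : Hamiltonian Λ D} {μ s : ℝ} (hμ : 0 < μ)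
    (hs : 0 < s) (h : H.IsLocal μ s) :
    H.LiebRobinsonBound (8 * s / μ) fun r => 2 * Real.exp (-(μ / 4) * r) := by
  intro X Y A B hA hB hr t ht
  set r := setDist X Y with hr_def
  have hXY : ∀ i ∈ X, ∀ j ∈ Y, r ≤ dist i j := fun i hi j hj =>
    ciInf_le (f := fun p : X × Y => dist (p.1 : Λ) (p.2 : Λ)) (Set.finite_range _).bddBelow
      (⟨i, hi⟩, ⟨j, hj⟩)
  have hdisj : Disjoint X Y := Finset.disjoint_left.mpr fun i hX hY => by
    have := hXY i hX i hY
    rw [dist_self] at this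
    linarith
  refine (norm_commutator_heisenberg_le hμ.le hs.le h hA hB hdisj hXY t).trans ?_
  set x := 2 * s * |t| with hx
  have hx0 : 0 ≤ x := by positivity
  -- The velocity `8 s / μ` is chosen so that `|t| ≤ r / v` reads `2 s |t| ≤ μ r / 4`.
  have hxr : x ≤ μ / 4 * r := by
    rw [le_div_iff₀ (by positivity), mul_div_assoc', div_le_iff₀ hμ] at ht
    linarith
  have h1 : Real.exp x - 1 ≤ x * Real.exp x := by
    have := Real.add_one_le_exp (-x)
    have h2 : Real.exp x * Real.exp (-x) = 1 := by rw [← Real.exp_add]; simp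
    nlinarith [Real.exp_pos x]
  have h3 : 8 * s / μ * |t| / r = x / (μ / 4 * r) := by
    rw [hx]; field_simp; ring
  have h4 : x * Real.exp x * Real.exp (-μ * r) ≤
      x / (μ / 4 * r) * Real.exp (-(μ / 4) * r) := by
    set y := μ / 4 * r with hy
    have hy0 : 0 < y := by positivity
    -- The decay is cut into four factors `exp (-y)`: one pays for dividing by `y`, one absorbs `exp
    -- x`, one is discarded and one is the tail.
    have e1 : -μ * r = -y + (-y) + (-y) + -y := by rw [hy]; ring
    have e2 : -(μ / 4) * r = -y := by rw [hy]; ring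
    have h5 : y * Real.exp (-y) ≤ 1 := by
      have h6 := Real.add_one_le_exp y
      rw [Real.exp_neg]
      exact (mul_inv_le_iff₀ (Real.exp_pos y)).mpr (by linarith)
    have h6 : Real.exp x * Real.exp (-y) ≤ 1 := by
      rw [← Real.exp_add]
      exact Real.exp_le_one_iff.mpr (by linarith)
    have h7 : Real.exp (-y) ≤ 1 := Real.exp_le_one_iff.mpr (by linarith)
    rw [e1, e2, Real.exp_add, Real.exp_add, Real.exp_add, div_mul_eq_mul_div, le_div_iff₀ hy0]
    calc _ = x * ((y * Real.exp (-y)) * (Real.exp x * Real.exp (-y)) * Real.exp (-y)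
            * Real.exp (-y)) := by ring
      _ ≤ x * (1 * 1 * 1 * Real.exp (-y)) := by gcongr
      _ = _ := by ring
  rw [h3]
  calc _ ≤ 2 * ‖A‖ * ‖B‖ * ((X.card : ℝ) * Real.exp (-μ * r) * (x * Real.exp x)) := by gcongr
    _ = 2 * ‖A‖ * ‖B‖ * (X.card : ℝ) * (x * Real.exp x * Real.exp (-μ * r)) := by ring
    _ ≤ 2 * ‖A‖ * ‖B‖ * (X.card : ℝ) * (x / (μ / 4 * r) * Real.exp (-(μ / 4) * r)) := by gcongr
    _ = _ := by ring

end Metric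
end SpinSystem
end

noncomputable section

namespace SpinSystem

variable {Λ : Type*} [Fintype Λ] [DecidableEq Λ] {D : ℕ}

/-! ### Projecting operators to the span of orthonormal states -/

section Projected

variable {k : ℕ}

/-- The matrix whose columns are the states `ψ a`. -/
def stateMatrix (ψ : Fin k → State Λ D) : Matrix (Λ → Fin D) (Fin k) ℂ :=
  Matrix.of fun x a => ψ a x

lemma projected_eq (ψ : Fin k → State Λ D) (O : Operator Λ D) :
    projected ψ O = (stateMatrix ψ).conjTranspose * (O * stateMatrix ψ) := by
  ext a b
  rw [projected, Matrix.of_apply, EuclideanSpace.inner_eq_star_dotProduct, dotProduct_comm]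
  rfl

lemma projected_sub (ψ : Fin k → State Λ D) (O O' : Operator Λ D) :
    projected ψ (O - O') = projected ψ O - projected ψ O' := by
  rw [projected_eq, projected_eq, projected_eq, Matrix.sub_mul, Matrix.mul_sub]

lemma orthonormal_iff_projected_one (ψ : Fin k → State Λ D) :
    Orthonormal ℂ ψ ↔ projected ψ 1 = 1 := by
  rw [orthonormal_iff_ite, ← Matrix.ext_iff]
  simp [projected, Matrix.one_apply]

/-- The projected matrix is `V* O V` with `V* V = 1`, hence `‖V‖ ≤ 1`; for `k = 0` the norm is `0`.
-/
lemma norm_projected_le {ψ : Fin k → State Λ D} (hψ : Orthonormal ℂ ψ) (O : Operator Λ D) :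
    ‖projected ψ O‖ ≤ ‖O‖ := by
  have h1 : ‖stateMatrix ψ‖ * ‖stateMatrix ψ‖ ≤ 1 := by
    rw [← Matrix.l2_opNorm_conjTranspose_mul_self]
    have := (orthonormal_iff_projected_one ψ).mp hψ
    rw [projected_eq, Matrix.one_mul] at this
    rw [this]
    rcases subsingleton_or_nontrivial (Matrix (Fin k) (Fin k) ℂ) with h | h
    · rw [Subsingleton.elim (1 : Matrix (Fin k) (Fin k) ℂ) 0, norm_zero]
      exact zero_le_one
    · exact (CStarRing.norm_one).le
  rw [projected_eq]
  calc _ ≤ ‖(stateMatrix ψ).conjTranspose‖ * (‖O‖ * ‖stateMatrix ψ‖) :=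
        (Matrix.l2_opNorm_mul _ _).trans
          (mul_le_mul_of_nonneg_left (Matrix.l2_opNorm_mul _ _) (norm_nonneg _))
    _ = ‖O‖ * (‖stateMatrix ψ‖ * ‖stateMatrix ψ‖) := by
        rw [Matrix.l2_opNorm_conjTranspose]; ring
    _ ≤ ‖O‖ := mul_le_of_le_one_right (norm_nonneg _) h1

lemma projected_evolve (H : Hamiltonian Λ D) (t : ℝ) (ψ : Fin k → State Λ D) (O : Operator Λ D) :
    projected (fun a => H.evolve t (ψ a)) O = projected ψ (H.heisenberg t O) := by
  have h : stateMatrix (fun a => H.evolve t (ψ a)) = H.evolution t * stateMatrix ψ := rfl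
  have h' : (H.evolution t).conjTranspose = H.evolution (-t) :=
    star_propagator H.isSelfAdjoint_total t
  rw [projected_eq, projected_eq, h, Matrix.conjTranspose_mul, h', Hamiltonian.heisenberg]
  simp only [Matrix.mul_assoc]

lemma orthonormal_evolve (H : Hamiltonian Λ D) (t : ℝ) {ψ : Fin k → State Λ D}
    (hψ : Orthonormal ℂ ψ) : Orthonormal ℂ fun a => H.evolve t (ψ a) := by
  rw [orthonormal_iff_projected_one] at hψ ⊢
  rw [projected_evolve, H.heisenberg_eq, mul_one, propagator_neg_mul_self, hψ]

lemma Hamiltonian.evolve_evolve (H : Hamiltonian Λ D) (s t : ℝ) (φ : State Λ D) :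
    H.evolve s (H.evolve t φ) = H.evolve (s + t) φ := by
  simp only [Hamiltonian.evolve, H.evolution_eq_propagator, propagator_add]
  rw [Matrix.toLpLin_mul_same]
  rfl

lemma Hamiltonian.evolve_zero (H : Hamiltonian Λ D) (φ : State Λ D) : H.evolve 0 φ = φ := by
  simp [Hamiltonian.evolve, H.evolution_eq_propagator, propagator_zero]

lemma norm_apply_le_l2_opNorm {m n : Type*} [Fintype m] [Fintype n] [DecidableEq n]
    (M : Matrix m n ℂ) (i : m) (j : n) : ‖M i j‖ ≤ ‖M‖ := by
  have h := Matrix.l2_opNorm_mulVec M (EuclideanSpace.single j 1)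
  rw [PiLp.norm_single, norm_one, mul_one] at h
  refine le_trans ?_ ((PiLp.norm_apply_le _ i).trans h)
  simp

end Projected

/-! ### Topological order under time evolution -/

section Metric

variable [MetricSpace Λ]

lemma TopologicalOrder.mono {k : ℕ} {ψ : Fin k → State Λ D} {l ε ε' : ℝ}
    (h : TopologicalOrder ψ l ε) (hε : ε ≤ ε') : TopologicalOrder ψ l ε' := by
  refine ⟨h.1, fun X O hX hO => ?_⟩
  obtain ⟨z, hz⟩ := h.2 X O hX hO
  exact ⟨z, hz.trans (by gcongr)⟩

/-- The sign of `ε` is not assumed: testing the order on the identity, supported on `∅`, forces `0 ≤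
ε` unless the operator algebra is trivial. -/
lemma TopologicalOrder.mul_norm_le {k : ℕ} {ψ : Fin k → State Λ D} {l ε : ℝ}
    (h : TopologicalOrder ψ l ε) (hl : 0 ≤ l) {A B : Operator Λ D} (hAB : ‖A‖ ≤ ‖B‖) :
    ε * ‖A‖ ≤ ε * ‖B‖ := by
  rcases subsingleton_or_nontrivial (Operator Λ D) with h' | h'
  · rw [Subsingleton.elim A B]
  · obtain ⟨z, hz⟩ := h.2 ∅ 1 (by simpa) (supportedOn_one _)
    rw [CStarRing.norm_one, mul_one] at hz
    exact mul_le_mul_of_nonneg_left hAB ((norm_nonneg _).trans hz)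

lemma topologicalOrder_of_one_le {k : ℕ} {ψ : Fin k → State Λ D} (h : Orthonormal ℂ ψ) (l : ℝ)
    {ε : ℝ} (hε : 1 ≤ ε) : TopologicalOrder ψ l ε := by
  refine ⟨h, fun X O _ _ => ⟨0, ?_⟩⟩
  rw [zero_smul, sub_zero]
  exact (norm_projected_le h O).trans (le_mul_of_one_le_left (norm_nonneg _) hε)

/-- Short-time evolution degrades topological order in a controlled way. -/
theorem TopologicalOrder.evolve {H : Hamiltonian Λ D} {μ s : ℝ} (hμ : 0 < μ) (hs : 0 < s)
    (h : H.IsLocal μ s) {d : ℕ} {C : ℝ} (hC : VolumeBound Λ d C) {t l m ε : ℝ} (hl : 1 ≤ l)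
    (hm : 8 * s / μ * |t| ≤ m) {k : ℕ} {φ : Fin k → State Λ D} (hφ : TopologicalOrder φ l ε) :
    TopologicalOrder (fun a => H.evolve t (φ a)) (l - m)
      (ε + 2 * Real.exp (-(μ / 4) * m) * (C * l ^ d)) := by
  refine ⟨orthonormal_evolve H t hφ.1, fun X O hX hO => ?_⟩
  have hm0 : 0 ≤ m := le_trans (by positivity) hm
  -- A neighbourhood of radius `m / 2` raises the diameter by at most `m`, which is exactly what the
  -- scale gives up.
  set X' : Finset Λ := Finset.univ.filter fun i => ∃ j ∈ X, dist i j ≤ m / 2 with hX'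
  have hXX' : X ⊆ X' := fun i hi => by
    simp only [hX', Finset.mem_filter, Finset.mem_univ, true_and]
    exact ⟨i, hi, by rw [dist_self]; positivity⟩
  have hdiam : Metric.diam (X' : Set Λ) ≤ l := by
    refine Metric.diam_le_of_forall_dist_le (by linarith) fun i hi j hj => ?_
    obtain ⟨i', hi', hii'⟩ := (Finset.mem_filter.mp hi).2
    obtain ⟨j', hj', hjj'⟩ := (Finset.mem_filter.mp hj).2
    have h1 : dist i' j' ≤ Metric.diam (X : Set Λ) :=
      Metric.dist_le_diam_of_mem X.finite_toSet.isBounded hi' hj'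
    have h2 := dist_triangle4 i i' j' j
    rw [dist_comm j' j] at h2
    linarith
  have hcard : (X.card : ℝ) ≤ C * l ^ d := hC X l hl (by linarith)
  have hst : 2 * s * |t| ≤ μ / 4 * m := by
    rw [div_mul_eq_mul_div, div_le_iff₀ hμ] at hm
    linarith
  obtain ⟨O', hO', hnorm, hdist⟩ := exists_supportedOn_norm_sub_le X' (H.heisenberg t O)
    (δ := 2 * Real.exp (-(μ / 4) * m) * X.card * ‖O‖) (by positivity) fun W hW hWX => by
      refine (norm_commutator_heisenberg_le hμ.le hs.le h hO hWX
        (Disjoint.mono_left hXX' disjoint_compl_right) (r := m / 2) (fun i hi j hj => ?_) t).trans ?_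
      · by_contra! hij
        refine Finset.mem_compl.mp hj (Finset.mem_filter.mpr ⟨Finset.mem_univ _, i, hi, ?_⟩)
        rw [dist_comm]
        exact hij.le
      · have hW1 : ‖W‖ ≤ 1 := by
          rcases subsingleton_or_nontrivial (Operator Λ D) with h' | h'
          · rw [Subsingleton.elim W 0, norm_zero]
            exact zero_le_one
          · exact (CStarRing.norm_of_mem_unitary hW).le
        -- Decay `exp (-μ m / 2)` over the distance `m / 2` beats the growth `exp (μ m / 4)`,
        -- leaving the tail rate `μ / 4`.
        have he : Real.exp (-μ * (m / 2)) * (Real.exp (2 * s * |t|) - 1) ≤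
            Real.exp (-(μ / 4) * m) := by
          calc _ ≤ Real.exp (-μ * (m / 2)) * Real.exp (μ / 4 * m) := by
                gcongr
                linarith [Real.exp_le_exp.mpr hst]
            _ = _ := by rw [← Real.exp_add]; congr 1; ring
        have he0 : 0 ≤ Real.exp (2 * s * |t|) - 1 :=
          sub_nonneg.mpr (Real.one_le_exp (by positivity))
        calc _ = 2 * ‖O‖ * ‖W‖ * (X.card *
              (Real.exp (-μ * (m / 2)) * (Real.exp (2 * s * |t|) - 1))) := by ring
          _ ≤ 2 * ‖O‖ * 1 * (X.card * Real.exp (-(μ / 4) * m)) := by gcongr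
          _ = _ := by ring
  rw [H.norm_heisenberg] at hnorm
  obtain ⟨z, hz⟩ := hφ.2 X' O' hdiam hO'
  refine ⟨z, ?_⟩
  have e : projected (fun a => H.evolve t (φ a)) O - z • (1 : Matrix (Fin k) (Fin k) ℂ) =
      (projected φ O' - z • (1 : Matrix (Fin k) (Fin k) ℂ)) +
        projected φ (H.heisenberg t O - O') := by
    rw [projected_evolve, projected_sub]; abel
  calc _ ≤ ε * ‖O'‖ + ‖H.heisenberg t O - O'‖ := by
        rw [e]
        exact (norm_add_le _ _).trans (add_le_add hz (norm_projected_le hφ.1 _))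
    _ ≤ ε * ‖O‖ + 2 * Real.exp (-(μ / 4) * m) * (C * l ^ d) * ‖O‖ := by
        refine add_le_add (hφ.mul_norm_le (by linarith) hnorm) (hdist.trans ?_)
        gcongr
    _ = _ := by ring

/-- Topological order after a short-time evolution was already there before it. -/
theorem TopologicalOrder.of_evolve {H : Hamiltonian Λ D} {μ s : ℝ} (hμ : 0 < μ) (hs : 0 < s)
    (h : H.IsLocal μ s) {d : ℕ} {C : ℝ} (hC : VolumeBound Λ d C) {t l m ε : ℝ} (hl : 1 ≤ l)
    (hm : 8 * s / μ * |t| ≤ m) {k : ℕ} {φ : Fin k → State Λ D}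
    (hφ : TopologicalOrder (fun a => H.evolve t (φ a)) l ε) :
    TopologicalOrder φ (l - m) (ε + 2 * Real.exp (-(μ / 4) * m) * (C * l ^ d)) := by
  -- The time enters only through `|t|`, so the forward result applies to the evolved states at time
  -- `-t`.
  rw [← abs_neg] at hm
  simpa [H.evolve_evolve, H.evolve_zero] using hφ.evolve hμ hs h hC hl hm

/-- Exponentially good topological order at scale `L / 2` gives exponentially good topological
order at scale `L / 4` for times proportional to `L`. -/
theorem exists_topologicalOrder_evolve {μ s : ℝ} (hμ : 0 < μ) (hs : 0 < s) (d : ℕ)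
    (C c₀ κ₀ : ℝ) (hc₀ : 0 < c₀) (hκ₀ : 0 < κ₀) : ∃ c₁ κ₁ : ℝ, 0 < c₁ ∧ 0 < κ₁ ∧
      ∀ (Λ : Type*) [Fintype Λ] [DecidableEq Λ] [MetricSpace Λ] (D : ℕ)
        (H : Hamiltonian Λ D), H.IsLocal μ s → VolumeBound Λ d C →
      ∀ (k : ℕ) (φ : Fin k → State Λ D) (L t : ℝ), 0 < L → |t| ≤ L / (4 * (8 * s / μ)) →
        TopologicalOrder φ (L / 2) (c₀ * Real.exp (-κ₀ * L)) →
        TopologicalOrder (fun a => H.evolve t (φ a)) (L / 4) (c₁ * Real.exp (-κ₁ * L)) := by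
  -- With `m = L / 4` the tail is `2 exp (-(μ / 16) L)`; half of this rate is spent on the volume
  -- factor `(L / 2) ^ d`.
  set κ := min κ₀ (μ / 32)
  have hκ : 0 < κ := lt_min hκ₀ (by positivity)
  set b : ℝ := 2 * (|C| * ((16 / μ) ^ d * d.factorial))
  have hb : 0 ≤ b := by positivity
  refine ⟨c₀ + b + Real.exp (2 * κ), κ, by positivity, hκ, ?_⟩
  intro Λ _ _ _ D H hH hC k φ L t hL ht hφ
  -- The volume bound needs `L / 2 ≥ 1`. For smaller `L` the summand `exp (2 κ)` makes the claimed
  -- error at least `1`, which is no constraint.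
  rcases lt_or_ge L 2 with hL2 | hL2
  · refine topologicalOrder_of_one_le (orthonormal_evolve H t hφ.1) _ ?_
    calc (1 : ℝ) ≤ Real.exp (2 * κ) * Real.exp (-κ * L) := by
          rw [← Real.exp_add]
          exact Real.one_le_exp (by nlinarith)
      _ ≤ _ := by gcongr; linarith
  · have hm : 8 * s / μ * |t| ≤ L / 4 := by
      rw [le_div_iff₀ (by positivity)] at ht
      linarith
    have key := hφ.evolve hμ hs hH hC (by linarith) hm
    rw [show L / 2 - L / 4 = L / 4 by ring] at key
    refine key.mono ?_
    have h1 : Real.exp (-κ₀ * L) ≤ Real.exp (-κ * L) := by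
      gcongr
      exact min_le_left _ _
    have h2 : Real.exp (-(μ / 32) * L) ≤ Real.exp (-κ * L) := by
      gcongr
      exact min_le_right _ _
    have h3 : (L / 2) ^ d ≤ (16 / μ) ^ d * d.factorial * Real.exp (μ / 32 * L) := by
      have h4 := Real.pow_div_factorial_le_exp (μ / 32 * L) (by positivity) d
      rw [div_le_iff₀ (by positivity)] at h4
      calc (L / 2) ^ d = (16 / μ) ^ d * (μ / 32 * L) ^ d := by
            rw [← mul_pow]; congr 1; field_simp; norm_num
        _ ≤ (16 / μ) ^ d * (Real.exp (μ / 32 * L) * d.factorial) := by gcongr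
        _ = _ := by ring
    have h5 : 2 * Real.exp (-(μ / 4) * (L / 4)) * (C * (L / 2) ^ d) ≤
        b * Real.exp (-(μ / 32) * L) := by
      calc _ ≤ 2 * Real.exp (-(μ / 4) * (L / 4)) *
            (|C| * ((16 / μ) ^ d * d.factorial * Real.exp (μ / 32 * L))) := by
            gcongr
            exact le_abs_self C
        _ = b * (Real.exp (-(μ / 4) * (L / 4)) * Real.exp (μ / 32 * L)) := by ring
        _ = _ := by rw [← Real.exp_add]; congr 2; ring
    calc _ ≤ c₀ * Real.exp (-κ * L) + b * Real.exp (-κ * L) :=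
          add_le_add (by gcongr) (h5.trans (by gcongr))
      _ ≤ c₀ * Real.exp (-κ * L) + b * Real.exp (-κ * L) +
          Real.exp (2 * κ) * Real.exp (-κ * L) := le_add_of_nonneg_right (by positivity)
      _ = _ := by ring

end Metric
end SpinSystem
end

noncomputable section

namespace SpinSystem

variable {Λ : Type*} [Fintype Λ] [DecidableEq Λ] {D : ℕ}

/-! ### Product states have no partner -/

section Projections

variable {E : Type*} [NormedAddCommGroup E] [InnerProductSpace ℂ E]

lemma norm_sq_eq_of_symmetric_idempotent {T : E →ₗ[ℂ] E} (hT : T.IsSymmetric)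
    (hTT : ∀ x, T (T x) = T x) (x : E) : ‖x‖ ^ 2 = ‖T x‖ ^ 2 + ‖x - T x‖ ^ 2 := by
  have h : inner ℂ (T x) (x - T x) = 0 := by
    rw [inner_sub_right, hT x x, hT x (T x), hTT, sub_self]
  have := norm_add_sq_eq_norm_sq_add_norm_sq_of_inner_eq_zero _ _ h
  rw [add_sub_cancel] at this
  simpa [sq] using this

/-- A union bound for commuting orthogonal projections. -/
lemma norm_sq_sub_le_sum {ι : Type*} [DecidableEq ι] {T : Finset ι → E →ₗ[ℂ] E}
    (hT : ∀ S, (T S).IsSymmetric) (h₀ : ∀ x, T ∅ x = x)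
    (hU : ∀ S S' x, T S (T S' x) = T (S ∪ S') x) (x : E) (S : Finset ι) :
    ‖x‖ ^ 2 - ‖T S x‖ ^ 2 ≤ ∑ i ∈ S, ‖x - T {i} x‖ ^ 2 := by
  have hid : ∀ S x, T S (T S x) = T S x := fun S x => by rw [hU, Finset.union_self]
  induction S using Finset.induction_on with
  | empty => simp [h₀]
  | insert i S hi ih =>
    rw [Finset.sum_insert hi]
    have h1 := norm_sq_eq_of_symmetric_idempotent (hT {i}) (hid {i}) (T S x)
    have h2 := norm_sq_eq_of_symmetric_idempotent (hT S) (hid S) (x - T {i} x)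
    have h3 : T {i} (T S x) = T (insert i S) x := by rw [hU, Finset.insert_eq]
    have h4 : T S (x - T {i} x) = T S x - T {i} (T S x) := by
      rw [map_sub, hU, hU, Finset.union_comm]
    rw [h3] at h1 h4
    rw [h4] at h2
    -- Adding `i` loses the squared norm of `T S (x - T {i} x)`, at most that of `x - T {i} x`
    -- because `T S` is a contraction.
    nlinarith [sq_nonneg ‖x - T {i} x - (T S x - T (insert i S) x)‖]

end Projections

/-- The tensor product of one operator for each site. -/
def siteTensor (A : Λ → Matrix (Fin D) (Fin D) ℂ) : Operator Λ D :=
  Matrix.of fun x y => ∏ i, A i (x i) (y i)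

lemma siteTensor_mul (A B : Λ → Matrix (Fin D) (Fin D) ℂ) :
    siteTensor A * siteTensor B = siteTensor fun i => A i * B i := by
  ext x y
  simp only [siteTensor, Matrix.mul_apply, Matrix.of_apply, ← Finset.prod_mul_distrib]
  rw [Finset.prod_univ_sum, Fintype.piFinset_univ]

lemma siteTensor_one : siteTensor (fun _ => 1 : Λ → Matrix (Fin D) (Fin D) ℂ) = 1 := by
  ext x y
  simp only [siteTensor, Matrix.of_apply, Matrix.one_apply]
  rw [Finset.prod_ite_zero]
  simp [funext_iff]

lemma siteTensor_isHermitian {A : Λ → Matrix (Fin D) (Fin D) ℂ} (h : ∀ i, (A i).IsHermitian) :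
    (siteTensor A).IsHermitian := by
  ext x y
  simp only [siteTensor, Matrix.conjTranspose_apply, Matrix.of_apply, star_prod]
  exact Finset.prod_congr rfl fun i _ => (h i).apply _ _

/-- The projection onto the states that agree with `u` at the sites in `S`. -/
def productProj (u : Λ → EuclideanSpace ℂ (Fin D)) (S : Finset Λ) : Operator Λ D :=
  siteTensor fun i => if i ∈ S then Matrix.vecMulVec (u i) (star (u i : Fin D → ℂ)) else 1

variable {u : Λ → EuclideanSpace ℂ (Fin D)}

lemma productProj_empty : productProj u ∅ = 1 := by
  simp [productProj, siteTensor_one]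

lemma productProj_isHermitian (S : Finset Λ) : (productProj u S).IsHermitian := by
  refine siteTensor_isHermitian fun i => ?_
  split_ifs
  · ext a b
    simp [Matrix.vecMulVec_apply, mul_comm]
  · exact Matrix.isHermitian_one

lemma productProj_mul (hu : ∀ i, ‖u i‖ = 1) (S T : Finset Λ) :
    productProj u S * productProj u T = productProj u (S ∪ T) := by
  rw [productProj, productProj, siteTensor_mul, productProj]
  congr 1
  funext i
  have h : star (u i : Fin D → ℂ) ⬝ᵥ (u i : Fin D → ℂ) = 1 := by
    have := inner_self_eq_norm_sq_to_K (𝕜 := ℂ) (u i)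
    rw [EuclideanSpace.inner_eq_star_dotProduct, hu i, dotProduct_comm] at this
    simpa using this
  by_cases hS : i ∈ S <;> by_cases hT : i ∈ T <;>
    simp [hS, hT, Matrix.vecMulVec_mul_vecMulVec, h]

lemma supportedOn_productProj_singleton (i : Λ) : SupportedOn {i} (productProj u {i}) := by
  refine ⟨fun p q => Matrix.vecMulVec (u i) (star (u i : Fin D → ℂ))
    (p ⟨i, Finset.mem_singleton_self i⟩) (q ⟨i, Finset.mem_singleton_self i⟩), fun x y => ?_⟩
  rw [productProj, siteTensor, Matrix.of_apply,
    ← Finset.mul_prod_erase _ _ (Finset.mem_univ i)]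
  have : ∀ j ∈ Finset.univ.erase i, (if j ∈ ({i} : Finset Λ) then
      Matrix.vecMulVec (u j) (star (u j : Fin D → ℂ)) else 1) (x j) (y j) =
        if x j = y j then 1 else 0 := fun j hj => by
    rw [if_neg (by simpa using hj), Matrix.one_apply]
  rw [Finset.prod_congr rfl this, Finset.prod_ite_zero]
  simp

lemma SupportedOn.one_sub {X : Finset Λ} {O : Operator Λ D} (h : SupportedOn X O) :
    SupportedOn X (1 - O) := by
  obtain ⟨P, hP⟩ := h
  obtain ⟨Q, hQ⟩ := supportedOn_one (D := D) X
  refine ⟨Q - P, fun x y => ?_⟩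
  rw [Matrix.sub_apply, hP, hQ]
  split_ifs <;> simp

/-- A tensor product of rank-one projections is again of rank one, so the full projection
annihilates every state orthogonal to the product state. -/
lemma productProj_univ_apply (χ : State Λ D) :
    Matrix.toEuclideanLin (productProj u Finset.univ) χ =
      inner ℂ (productState u) χ • productState u := by
  ext x
  simp only [Matrix.toLpLin_apply, Matrix.mulVec, dotProduct, productProj, siteTensor,
    Matrix.of_apply, Finset.mem_univ, if_true, Matrix.vecMulVec_apply, Finset.prod_mul_distrib,
    PiLp.smul_apply, smul_eq_mul, PiLp.inner_apply, productState, Finset.sum_mul]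
  refine Finset.sum_congr rfl fun y _ => ?_
  simp only [Pi.star_apply, RCLike.inner_apply, map_prod, starRingEnd_apply]
  ring

lemma norm_le_one_of_isHermitian_of_idempotent {n : Type*} [Fintype n] [DecidableEq n]
    {P : Matrix n n ℂ} (hP : P.IsHermitian) (hPP : P * P = P) : ‖P‖ ≤ 1 := by
  have h := Matrix.l2_opNorm_conjTranspose_mul_self P
  rw [hP.eq, hPP] at h
  nlinarith [norm_nonneg P]

/-- A product state has no partner with which it is well topologically ordered. -/
theorem le_of_topologicalOrder_productState [MetricSpace Λ] (hu : ∀ i, ‖u i‖ = 1) {χ : State Λ D}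
    {l ε : ℝ} (hl : 0 ≤ l) (h : TopologicalOrder ![productState u, χ] l ε) :
    1 / (2 * (Fintype.card Λ : ℝ)) ≤ ε := by
  set φ := productState u
  set T : Finset Λ → State Λ D →ₗ[ℂ] State Λ D := fun S => Matrix.toEuclideanLin (productProj u S)
  have hT : ∀ S, (T S).IsSymmetric := fun S =>
    Matrix.isSymmetric_toEuclideanLin_iff.mpr (productProj_isHermitian S)
  have hU : ∀ S S' x, T S (T S' x) = T (S ∪ S') x := fun S S' x => by
    simp only [T, ← productProj_mul hu, Matrix.toLpLin_mul_same]
    rfl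
  have h₀ : ∀ x, T ∅ x = x := fun x => by simp [T, productProj_empty]
  have hφ : ‖φ‖ = 1 := h.1.1 0
  have hχ : ‖χ‖ = 1 := h.1.1 1
  have hφχ : inner ℂ φ χ = 0 := h.1.2 (i := 0) (j := 1) (by decide)
  have hTφ : ∀ i, T {i} φ = φ := fun i => by
    have : T Finset.univ φ = φ := by
      rw [productProj_univ_apply, inner_self_eq_norm_sq_to_K, hφ]; simp [φ]
    calc T {i} φ = T {i} (T Finset.univ φ) := by rw [this]
      _ = φ := by rw [hU, Finset.union_eq_right.mpr (Finset.subset_univ _), this]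
  have hTχ : T Finset.univ χ = 0 := by
    rw [productProj_univ_apply, hφχ, zero_smul]
  have hne : Nonempty (Λ → Fin D) := by
    by_contra hemp
    rw [not_nonempty_iff] at hemp
    rw [Subsingleton.elim φ 0, norm_zero] at hφ
    exact zero_ne_one hφ
  have hε : 0 ≤ ε := by
    obtain ⟨z, hz⟩ := h.2 ∅ 1 (by simpa) (supportedOn_one _)
    rw [CStarRing.norm_one, mul_one] at hz
    exact (norm_nonneg _).trans hz
  have hp : ∀ i ∈ (Finset.univ : Finset Λ), ‖χ - T {i} χ‖ ^ 2 ≤ 2 * ε := by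
    intro i _
    -- The test operator lives on one site, a set of diameter `0`. Its expectation vanishes in `φ`,
    -- so `‖z‖ ≤ ε`; its expectation in `χ` is within `ε` of `z`, hence at most `2 ε`.
    set P : Operator Λ D := 1 - productProj u {i} with hP
    have hPlin : ∀ x, Matrix.toEuclideanLin P x = x - T {i} x := fun x => by
      simp [hP, T, map_sub]
    have hPP : P * P = P := by
      rw [hP, mul_sub, sub_mul, sub_mul, productProj_mul hu]; simp
    have hPH : P.IsHermitian := Matrix.isHermitian_one.sub (productProj_isHermitian _)
    obtain ⟨z, hz⟩ := h.2 {i} P (by simpa using hl) (supportedOn_productProj_singleton i).one_sub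
    have hz' := hz.trans (mul_le_of_le_one_right hε
      (norm_le_one_of_isHermitian_of_idempotent hPH hPP))
    have h0 : ‖z‖ ≤ ε := by
      have := (norm_apply_le_l2_opNorm _ 0 0).trans hz'
      simpa [projected, hPlin, hTφ] using this
    have h1 : ‖((‖χ - T {i} χ‖ ^ 2 : ℝ) : ℂ) - z‖ ≤ ε := by
      have h2 : inner ℂ χ (χ - T {i} χ) = ((‖χ - T {i} χ‖ ^ 2 : ℝ) : ℂ) := by
        have h3 : inner ℂ (T {i} χ) (χ - T {i} χ) = 0 := by
          rw [hT {i} χ, map_sub, hU, Finset.union_self, sub_self, inner_zero_right]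
        calc _ = inner ℂ (χ - T {i} χ) (χ - T {i} χ) := by rw [inner_sub_left, h3, sub_zero]
          _ = _ := by rw [inner_self_eq_norm_sq_to_K]; push_cast; rfl
      have := (norm_apply_le_l2_opNorm _ 1 1).trans hz'
      rw [← h2]
      simpa [projected, hPlin] using this
    have h4 := norm_add_le (((‖χ - T {i} χ‖ ^ 2 : ℝ) : ℂ) - z) z
    rw [sub_add_cancel, Complex.norm_real, Real.norm_of_nonneg (by positivity)] at h4
    linarith
  -- Since the full projection kills the unit vector `χ`, the union bound reads `1 ≤ |Λ| * (2 ε)`.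
  have hsum := (norm_sq_sub_le_sum hT h₀ hU χ Finset.univ).trans
    (Finset.sum_le_card_nsmul _ _ _ hp)
  rw [hTχ, hχ, norm_zero, Finset.card_univ, nsmul_eq_mul] at hsum
  refine div_le_of_le_mul₀ (by positivity) hε ?_
  linarith

end SpinSystem
end

/-! ### Stability of topological order, with explicit velocity and tail -/

theorem mainTheorem8 (μ s : ℝ) (hμ : 0 < μ) (hs : 0 < s) :
    -- `v` and `g` depend only on `μ` and `s`
    ∃ (v : ℝ) (g : ℝ → ℝ), 0 < v ∧ SpinSystem.ExponentiallyDecaying g ∧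
      (∀ (Λ : Type*) [Fintype Λ] [DecidableEq Λ] [MetricSpace Λ] (D : ℕ)
        (H : SpinSystem.Hamiltonian Λ D), H.IsLocal μ s →
        -- `v` is a Lieb-Robinson velocity, with tail function `g`
        H.LiebRobinsonBound v g ∧
        ∀ (d : ℕ) (C : ℝ), SpinSystem.VolumeBound Λ d C →
        ∀ (t l m ε : ℝ), 1 ≤ l → v * |t| ≤ m →
          -- evolution degrades topological order in a controlled way
          (∀ (k : ℕ) (φ : Fin k → SpinSystem.State Λ D),
            SpinSystem.TopologicalOrder φ l ε →
            SpinSystem.TopologicalOrder (fun a => H.evolve t (φ a))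
              (l - m) (ε + g m * (C * l ^ d))) ∧
          -- topological order after the evolution was already there before it
          (∀ (k : ℕ) (φ : Fin k → SpinSystem.State Λ D),
            SpinSystem.TopologicalOrder (fun a => H.evolve t (φ a)) l ε →
            SpinSystem.TopologicalOrder φ (l - m) (ε + g m * (C * l ^ d))) ∧
          -- an evolved product state has no partner with which it is well topologically ordered
          (∀ (u : Λ → EuclideanSpace ℂ (Fin D)), (∀ i, ‖u i‖ = 1) → m ≤ l →
            ∀ ψ' : SpinSystem.State Λ D,
            SpinSystem.TopologicalOrder ![H.evolve t (SpinSystem.productState u), ψ'] l ε →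
            1 / (2 * (Fintype.card Λ : ℝ)) ≤ ε + g m * (C * l ^ d))) ∧
      -- exponentially good topological order at scale `L / 2` gives exponentially good
      -- topological order at scale `L / 4` for times up to `L / (4 v)`
      (∀ (d : ℕ) (C c₀ κ₀ : ℝ), 0 < c₀ → 0 < κ₀ → ∃ c₁ κ₁ : ℝ, 0 < c₁ ∧ 0 < κ₁ ∧
        ∀ (Λ : Type*) [Fintype Λ] [DecidableEq Λ] [MetricSpace Λ] (D : ℕ)
          (H : SpinSystem.Hamiltonian Λ D), H.IsLocal μ s → SpinSystem.VolumeBound Λ d C →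
        ∀ (k : ℕ) (φ : Fin k → SpinSystem.State Λ D) (L t : ℝ), 0 < L → |t| ≤ L / (4 * v) →
          SpinSystem.TopologicalOrder φ (L / 2) (c₀ * Real.exp (-κ₀ * L)) →
          SpinSystem.TopologicalOrder (fun a => H.evolve t (φ a)) (L / 4)
            (c₁ * Real.exp (-κ₁ * L))) := by
  refine ⟨8 * s / μ, fun r => 2 * Real.exp (-(μ / 4) * r), by positivity,
    ⟨2, μ / 4, by positivity, by positivity, fun r _ => ⟨by positivity, le_rfl⟩⟩, ?_, ?_⟩
  · intro Λ _ _ _ D H hH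
    refine ⟨hH.liebRobinsonBound hμ hs, fun d C hC t l m ε hl hm => ⟨?_, ?_, ?_⟩⟩
    · exact fun k φ hφ => hφ.evolve hμ hs hH hC hl hm
    · exact fun k φ hφ => hφ.of_evolve hμ hs hH hC hl hm
    · intro u hu hml ψ' hψ
      -- The partner is evolved back together with the product state; `m ≤ l` keeps the remaining
      -- scale nonnegative, so single-site tests stay available.
      refine SpinSystem.le_of_topologicalOrder_productState hu (χ := H.evolve (-t) ψ')
        (sub_nonneg.mpr hml) (SpinSystem.TopologicalOrder.of_evolve hμ hs hH hC hl hm ?_)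
      convert hψ using 1
      funext a
      fin_cases a
      · rfl
      · simp [H.evolve_evolve, H.evolve_zero]
  · exact fun d C c₀ κ₀ hc₀ hκ₀ =>
      SpinSystem.exists_topologicalOrder_evolve hμ hs d C c₀ κ₀ hc₀ hκ₀
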